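/- **Setting.** Let $n,m\ge 0$, $\bar q\ge 1$, $\mathcal Q=\{1,\dots,\bar q\}$, $\tau_d>0$, $N_0\ge 1$. For each mode $q\in\mathcal Q$ let $f_q:\mathbb R^n\times\mathbb R^m\times\mathbb R_{\ge0}\times\mathbb R_{\ge1}\to\mathbb R^n$, $(x,u,\tau,\mu)\mapsto f_q(x,u,\tau,\mu)$, be locally Lipschitz (it may be independent of $\mu$) and let $R_q:\mathbb R^n\to\mathbb R^n$ be continuous. For $T>0$ consider the hybrid system with state $z=(x,\tau,q,\mu_1)$ and continuous bounded input $u:\mathbb R_{\ge0}\to\mathbb R^m$, $$z\in\mathbb R^n\times[0,N_0]\times\mathcal Q\times\mathbb R_{\ge1}:\quad \dot x=\mu_1 f_q(x,u,\tau,\mu_1),\quad \dot\tau\in[0,\mu_1/\tau_d],\quad \dot q=0,\quad \dot\mu_1=\tfrac1T\mu_1^2,$$ $$z\in\mathbb R^n\times[1,N_0]\times\mathcal Q\times\mathbb R_{\ge1}:\quad x^+=R_q(x),\quad \tau^+=\tau-1,\quad q^+\in\mathcal Q\setminus\{q\},\quad \mu_1^+=\mu_1.$$ Solutions are hybrid arcs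 on hybrid time domains (locally absolutely continuous during flows, flow conditions for almost every $t$, with $u(t,j)=u(t)$); they need not be maximal. Write $\mu_0=\mu_1(0,0)$, let $\mu_1(t)$ be the value of $\mu_1$ at $(t,j)$ (it does not change at jumps), and $|u|_{(t,j)}=\sup\{|u(\tilde t)|:(\tilde t,\tilde j)\in\mathrm{dom}(z),\ \tilde t\le t,\ \tilde j\le j\}$. **Hypothesis $(\mathrm L_\Delta)$,** for a function $\Delta:\mathbb R_{\ge1}\to\mathbb R_{\ge 0}$: there are $p>0$, constants $c_{q,1},\dots,c_{q,4}>0$, $\chi\in(0,1]$ and smooth functions $V_q:\mathbb R^n\times\mathbb R_{\ge0}\to\mathbb R_{\ge0}$ such that * $c_{q,1}|x|^p\le V_q(x,\tau)\le c_{q,2}|x|^p$ for all $q\in\mathcal Q$, $x\in\mathbb R^n$, $\tau\in[0,N_0]$; * $\langle\nabla V_q(x,\tau),(f_q(x,u,\tau,\mu),\eta)\rangle\le -c_{q,3}V_q(x,\tau)+c_{q,4}\Delta(\mu)|u|^p$ for all $q\in\mathcal Q$, $x\in\mathbb R^n$, $u\in\mathbb R^m$, $\tau\in[0,N_0]$,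 $\mu\ge1$, $\eta\in[0,\tau_d^{-1}]$; * $V_q(R_o(x),\tau-1)\le\chi V_o(x,\tau)$ for all $x\in\mathbb R^n$, $\tau\in[1,N_0]$ and $o\neq q$ in $\mathcal Q$; and moreover, with $r=\max_q c_{q,2}/\min_q c_{q,1}$, the dwell-time condition $\tau_d>\ln(r)/\min_q c_{q,3}$ holds. **Claim.** 1. Let $\Delta\in\{0,1\}$ be constant and suppose that $(\mathrm L_\Delta)$ holds. Then there are $\kappa_1,\kappa_2,\kappa_3>0$ such that for every $T>0$, every continuous bounded $u$, every solution $z$ and all $(t,j)\in\mathrm{dom}(z)$, $$|x(t,j)|\le\kappa_1\Big(\frac{\mu_0}{\mu_1(t)}\Big)^{\kappa_2T}e^{-\kappa_2j}|x(0,0)|+\kappa_3\,\Delta\,|u|_{(t,j)}.$$ 2. Let $\ell>0$ and suppose that $(\mathrm L_\Delta)$ holds with $\Delta(\mu)=\mu^{-\ell}$. Then for every $T>0$ there are $\alpha_1,\dots,\alpha_6>0$ such that for every continuous bounded $u$, every solution $z$ and all $(t,j)\in\mathrm{dom}(z)$, $$|x(t,j)|\le\frac{\alpha_1\mu_0^{\alpha_2}}{\mu_1(t)^{\alpha_3}}\Big(\frac{e^{-\alpha_4j}}{\mu_1(t)^{\alpha_5}}|x(0,0)|+\alpha_6|u|_{(t,j)}\Big).$$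 -/

import Mathlib

namespace PTHybrid

open Set MeasureTheory

open scoped ContDiff

/-! ### Hybrid time domains, hybrid inputs, hybrid arcs -/

/-- A compact hybrid time domain `⋃_{j < J} [t_j, t_{j+1}] × {j}` with
`0 = t_0 ≤ t_1 ≤ … ≤ t_J`. -/
def IsCompactHTD (E : Set (ℝ × ℕ)) : Prop :=
  ∃ (J : ℕ) (t : ℕ → ℝ), t 0 = 0 ∧ (∀ i < J, t i ≤ t (i + 1)) ∧
    E = ⋃ j ∈ Iio J, Icc (t j) (t (j + 1)) ×ˢ {j}

/-- A hybrid time domain: a subset of `ℝ_{≥0} × ℕ` all of whose truncations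
`E ∩ ([0,T] × {0,…,J})`, `(T,J) ∈ E`, are compact hybrid time domains. -/
def IsHTD (E : Set (ℝ × ℕ)) : Prop :=
  (∀ e ∈ E, 0 ≤ e.1) ∧ ∀ e ∈ E, IsCompactHTD (E ∩ (Icc 0 e.1 ×ˢ Iic e.2))

/-- The interval `I_j = {t : (t,j) ∈ E}`. -/
def flowInterval (E : Set (ℝ × ℕ)) (j : ℕ) : Set ℝ := {t | (t, j) ∈ E}

/-- A hybrid input on `E` (values outside `E` are irrelevant): for each `j`, `u(·,j)` is Lebesgue
measurable and locally essentially bounded on `I_j`. -/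
def IsHybridInput {U : Type*} [NormedAddCommGroup U] (E : Set (ℝ × ℕ)) (u : ℝ → ℕ → U) : Prop :=
  ∀ j, AEStronglyMeasurable (fun t => u t j) (volume.restrict (flowInterval E j)) ∧
    ∀ K ⊆ flowInterval E j, IsCompact K → ∃ M : ℝ, ∀ᵐ t ∂(volume.restrict K), ‖u t j‖ ≤ M

/-- A hybrid arc on `E` (values outside `E` are irrelevant): for each `j` such that `I_j` has
nonempty interior, `z(·,j)` is locally absolutely continuous on `I_j`. -/
def IsHybridArc {Z : Type*} [NormedAddCommGroup Z] (E : Set (ℝ × ℕ)) (z : ℝ → ℕ → Z) : Prop :=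
  ∀ j, (interior (flowInterval E j)).Nonempty →
    ∀ a b : ℝ, a ≤ b → Icc a b ⊆ flowInterval E j →
      AbsolutelyContinuousOnInterval (fun t => z t j) a b

/-- `|u|_{(t,j)}`: the supremum of `|u(s,i)|` over `(s,i) ∈ E` with `(s,i) ≤ (t,j)`. -/
noncomputable def inputSup {U : Type*} [NormedAddCommGroup U] (E : Set (ℝ × ℕ)) (u : ℝ → ℕ → U)
    (t : ℝ) (j : ℕ) : ℝ :=
  sSup {r : ℝ | ∃ s i, (s, i) ∈ E ∧ s ≤ t ∧ i ≤ j ∧ r = ‖u s i‖}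

/-! ### Hybrid dynamical systems with inputs and their solutions -/

/-- The data of a hybrid dynamical system
`ż ∈ F(z,u)` for `(z,u) ∈ C × U`, `z⁺ ∈ G(z)` for `(z,u) ∈ D × U`. -/
structure HybridSystem (Z U : Type*) where
  /-- The flow set is `C × U`. -/
  C : Set Z
  /-- The flow map. -/
  F : Z → U → Set Z
  /-- The jump set is `D × U`. -/
  D : Set Z
  /-- The jump map. -/
  G : Z → Set Z

/-- `(z,u)`, with common domain `E`, is a solution pair of the hybrid system `H`. It need not be
maximal or complete. -/
structure IsSolutionPair {Z U : Type*} [NormedAddCommGroup Z] [NormedSpace ℝ Z]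
    [NormedAddCommGroup U] (H : HybridSystem Z U) (E : Set (ℝ × ℕ))
    (z : ℝ → ℕ → Z) (u : ℝ → ℕ → U) : Prop where
  htd : IsHTD E
  arc : IsHybridArc E z
  input : IsHybridInput E u
  zero_mem : ((0 : ℝ), (0 : ℕ)) ∈ E
  init : z 0 0 ∈ H.C ∪ H.D
  flow : ∀ j, (interior (flowInterval E j)).Nonempty →
    ∀ᵐ t ∂(volume.restrict (flowInterval E j)),
      z t j ∈ H.C ∧ ∃ v ∈ H.F (z t j) (u t j), HasDerivAt (fun s => z s j) v t
  jump : ∀ t j, (t, j) ∈ E → (t, j + 1) ∈ E → z t j ∈ H.D ∧ z t (j + 1) ∈ H.G (z t j)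

/-! ### Hybrid systems with a blow-up gain -/

/-- The hybrid system with state `(ψ, μ)`, flow set `Ψ_C × ℝ_{≥1}`, jump set `Ψ_D × ℝ_{≥1}`, flows
`ψ̇ ∈ μ F_Ψ(ψ,u,μ)`, `μ̇ = (k/T) μ^{1+1/k}`, and jumps `ψ⁺ ∈ G_Ψ(ψ)`, `μ⁺ = μ`. -/
noncomputable def blowUpSystem {Y U : Type*} [NormedAddCommGroup Y] [NormedSpace ℝ Y]
    (T k : ℝ) (FY : Y → U → ℝ → Set Y) (GY : Y → Set Y) (CY DY : Set Y) :
    HybridSystem (Y × ℝ) U where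
  C := CY ×ˢ Ici 1
  F z u := {w | ∃ v ∈ FY z.1 u z.2, w = (z.2 • v, k / T * z.2 ^ (1 + 1 / k))}
  D := DY ×ˢ Ici 1
  G z := GY z.1 ×ˢ {z.2}

/-- `ℝⁿ` with the Euclidean norm. -/
abbrev Vec (n : ℕ) : Type := EuclideanSpace ℝ (Fin n)

/-- The value in `{1,…,q̄} ⊆ ℝ` of the logic state of the mode with index `i`. -/
def modeVal {N : ℕ} (i : Fin N) : ℝ := (i : ℕ) + 1

/-- The hybrid system of a switching system with resets, all of whose modes are stable. The state
is `z = ((x, τ, q), μ)`, and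
`F_Ψ = {f_q(x,u,τ,μ)} × [0, 1/τ_d] × {0}`, `G_Ψ = {R_q(x)} × {τ - 1} × (Q \ {q})`,
`Ψ_C = ℝⁿ × [0,N₀] × Q`, `Ψ_D = ℝⁿ × [1,N₀] × Q`, where `Q = {1,…,q̄}`. -/
noncomputable def switchingSystem {n m N : ℕ} (f : Fin N → Vec n × Vec m × ℝ × ℝ → Vec n)
    (R : Fin N → Vec n → Vec n) (τd N₀ T k : ℝ) :
    HybridSystem ((Vec n × ℝ × ℝ) × ℝ) (Vec m) :=
  blowUpSystem T k
    (fun ψ u μ => {w | ∃ i : Fin N, ψ.2.2 = modeVal i ∧ w.1 = f i (ψ.1, u, ψ.2.1, μ) ∧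
      w.2.1 ∈ Icc 0 (1 / τd) ∧ w.2.2 = 0})
    (fun ψ => {w | ∃ i o : Fin N, ψ.2.2 = modeVal i ∧ o ≠ i ∧
      w = (R i ψ.1, ψ.2.1 - 1, modeVal o)})
    (univ ×ˢ (Icc 0 N₀ ×ˢ range (modeVal (N := N))))
    (univ ×ˢ (Icc 1 N₀ ×ˢ range (modeVal (N := N))))

/-! ### The standing assumptions -/

/-- Regularity of the vector fields on `ℝⁿ × ℝᵐ × ℝ_{≥0} × ℝ_{≥1}` and of the resets. -/
structure RegularData {n m N : ℕ} (f : Fin N → Vec n × Vec m × ℝ × ℝ → Vec n)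
    (R : Fin N → Vec n → Vec n) : Prop where
  lipschitz : ∀ i, LocallyLipschitzOn {a : Vec n × Vec m × ℝ × ℝ | 0 ≤ a.2.2.1 ∧ 1 ≤ a.2.2.2} (f i)
  continuous : ∀ i, Continuous (R i)

/-- The exogenous input `u : ℝ_{≥0} → ℝᵐ` is continuous and bounded. -/
structure RegularInput {m : ℕ} (u : ℝ → Vec m) : Prop where
  continuous : ContinuousOn u (Ici 0)
  bounded : ∃ M : ℝ, ∀ t, 0 ≤ t → ‖u t‖ ≤ M

/-- The Lyapunov conditions, when every mode is stable, for the functions `V_q` on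
`ℝⁿ × ℝ_{≥0}`, the exponent `p`, the constants `c_{q,1}, …, c_{q,4}` and the input gain `Δ`.
The pairing `⟨∇V_q(x,τ), w⟩` is written as the derivative of `V_q` within `ℝⁿ × ℝ_{≥0}`, applied
to `w`. -/
structure LyapunovConditions {n m N : ℕ} (f : Fin N → Vec n × Vec m × ℝ × ℝ → Vec n)
    (R : Fin N → Vec n → Vec n) (Δ : ℝ → ℝ) (τd N₀ p : ℝ) (V : Fin N → Vec n × ℝ → ℝ)
    (c₁ c₂ c₃ c₄ : Fin N → ℝ) : Prop where
  exponent_pos : 0 < p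
  const_pos : ∀ i, 0 < c₁ i ∧ 0 < c₂ i ∧ 0 < c₃ i ∧ 0 < c₄ i
  smooth : ∀ i, ContDiffOn ℝ ∞ (V i) (univ ×ˢ Ici 0)
  nonneg : ∀ i x τ, 0 ≤ τ → 0 ≤ V i (x, τ)
  bounds : ∀ i x, ∀ τ ∈ Icc 0 N₀, c₁ i * ‖x‖ ^ p ≤ V i (x, τ) ∧ V i (x, τ) ≤ c₂ i * ‖x‖ ^ p
  decrease : ∀ i x u, ∀ τ ∈ Icc 0 N₀, ∀ μ ≥ (1 : ℝ), ∀ η ∈ Icc 0 (1 / τd),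
    fderivWithin ℝ (V i) (univ ×ˢ Ici 0) (x, τ) (f i (x, u, τ, μ), η) ≤
      -c₃ i * V i (x, τ) + c₄ i * Δ μ * ‖u‖ ^ p
  reset : ∃ χ : ℝ, 0 < χ ∧ χ ≤ 1 ∧ ∀ o i : Fin N, i ≠ o → ∀ x, ∀ τ ∈ Icc 1 N₀,
    V i (R o x, τ - 1) ≤ χ * V o (x, τ)

end PTHybrid

namespace PTHybrid

open Set MeasureTheory Filter Topology

/-! ### Absolutely continuous functions -/

/-! Write `V` for the Lyapunov function of the current mode. Two quantities are nonincreasing along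
every solution. The first is `(μ ^ a * V - M) * μ ^ (c * T / 2)`. In flows `V` decays at rate `c *
μ`, while `μ ^ r` grows at relative rate `r * μ / T`; half of the decay pays for the outer factor,
and the other half pays for `μ ^ a` if `a ≤ c * T / 2`. The offset `M` absorbs the input as soon as
`μ ^ a * Δ μ` is bounded. Jumps preserve `μ` and, because `χ ≤ 1`, never increase `V`, even though
the mode changes. The second is `τd * (τ + j) - T * log μ`: the timer grows at most at rate `μ /
τd`, `log μ` grows at rate `μ / T`, and a jump moves one unit from `τ` to `j`. Hence `j` is at most
`N₀ + (T / τd) * log (μ / μ₀)`, so part of the decay in `μ₀ / μ` can be traded for decay in `j`.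
`weighted_le_of_flow` and `sub_log_le_of_flow` give the monotonicity, `IsHTD.induction` propagates
it, and `norm_le_of_solution` makes the trade. -/

theorem absolutelyContinuousOnInterval_comp {X Y : Type*} [NormedAddCommGroup X]
    [PseudoMetricSpace Y] {g : ℝ → X} {F : X → Y} {S : Set X} {a b : ℝ} (hF : LocallyLipschitzOn S F)
    (hg : AbsolutelyContinuousOnInterval g a b) (hS : MapsTo g (uIcc a b) S) :
    AbsolutelyContinuousOnInterval (fun t => F (g t)) a b := by
  have hK : IsCompact (g '' uIcc a b) := isCompact_uIcc.image_of_continuousOn hg.continuousOn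
  have hF' : LocallyLipschitzOn (g '' uIcc a b) F := hF.mono hS.image_subset
  obtain ⟨K, hL⟩ := LocallyLipschitzOn.exists_lipschitzOnWith_of_compact hK hF'
  rw [absolutelyContinuousOnInterval_iff] at hg ⊢
  intro ε hε
  obtain ⟨δ, hδ, h⟩ := hg (ε / (K + 1)) (by positivity)
  refine ⟨δ, hδ, fun E hE hlt => ?_⟩
  have h1 := h E hE hlt
  rw [lt_div_iff₀ (by positivity)] at h1
  refine lt_of_le_of_lt ?_ h1
  rw [Finset.sum_mul]
  refine Finset.sum_le_sum fun i hi => ?_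
  have h2 := hL.dist_le_mul _ (mem_image_of_mem g (hE.1 i hi).1) _ (mem_image_of_mem g (hE.1 i hi).2)
  have h3 : 0 ≤ dist (g (E.2 i).1) (g (E.2 i).2) := dist_nonneg
  nlinarith

theorem locallyLipschitzOn_of_contDiffOn {X Y : Type*} [NormedAddCommGroup X] [NormedSpace ℝ X]
    [NormedAddCommGroup Y] [NormedSpace ℝ Y] {F : X → Y} {S : Set X} (hS : Convex ℝ S)
    (hF : ContDiffOn ℝ 1 F S) : LocallyLipschitzOn S F := fun x hx =>
  (hF x hx).exists_lipschitzOnWith hS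

/-- Absolute continuity gives the fundamental theorem of calculus, so an almost everywhere sign of
the derivative is enough. -/
theorem le_of_ae_hasDerivAt_nonpos {g : ℝ → ℝ} {a b : ℝ} (hab : a ≤ b)
    (hg : AbsolutelyContinuousOnInterval g a b)
    (hd : ∀ᵐ t, t ∈ Ioo a b → ∃ v ≤ 0, HasDerivAt g v t) : g b ≤ g a := by
  have h := hg.integral_deriv_eq_sub
  suffices h0 : 0 ≤ ∫ t in a..b, -deriv g t by
    rw [intervalIntegral.integral_neg] at h0
    linarith
  refine intervalIntegral.integral_nonneg_of_ae_restrict hab ?_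
  rw [← restrict_Ioo_eq_restrict_Icc, EventuallyLE, ae_restrict_iff' measurableSet_Ioo]
  filter_upwards [hd] with t ht htI
  obtain ⟨v, hv, h1⟩ := ht htI
  rw [h1.deriv]
  simpa using hv

/-- A set of full measure is dense, so flow conditions known almost everywhere extend to every time,
endpoints included. -/
theorem mem_of_ae_mem {Z : Type*} [TopologicalSpace Z] {z : ℝ → Z} {C : Set Z} {a b : ℝ}
    (hab : a < b) (hz : ContinuousOn z (Icc a b)) (hC : IsClosed C)
    (h : ∀ᵐ t, t ∈ Ioo a b → z t ∈ C) : ∀ t ∈ Icc a b, z t ∈ C := by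
  have hcl : IsClosed (Icc a b ∩ z ⁻¹' C) := hz.preimage_isClosed_of_isClosed isClosed_Icc hC
  have h1 := (Measure.dense_of_ae h).open_subset_closure_inter (isOpen_Ioo (a := a) (b := b))
  have h2 : closure (Ioo a b ∩ {t | t ∈ Ioo a b → z t ∈ C}) ⊆ Icc a b ∩ z ⁻¹' C :=
    closure_minimal (fun t ht => ⟨Ioo_subset_Icc_self ht.1, ht.2 ht.1⟩) hcl
  intro t ht
  rw [← closure_Ioo hab.ne] at ht
  exact (closure_minimal (h1.trans h2) hcl ht).2

/-! ### Induction along a hybrid time domain -/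

/-- Truncation at `(t, j)` leaves finitely many flow intervals, and one inducts on the jump count.
The flow case may assume `a < b`: degenerate intervals require nothing. -/
theorem IsHTD.induction {E : Set (ℝ × ℕ)} (hE : IsHTD E) {P : ℝ → ℕ → Prop} {t : ℝ} {j : ℕ}
    (htj : (t, j) ∈ E) (h0 : P 0 0)
    (hflow : ∀ i a b, a < b → b ≤ t → i ≤ j → Icc a b ⊆ flowInterval E i → P a i → P b i)
    (hjump : ∀ s i, (s, i) ∈ E → (s, i + 1) ∈ E → P s i → P s (i + 1)) : P t j := by
  obtain ⟨J, σ, hσ0, hmono, hEq⟩ := hE.2 _ htj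
  have hmem : ∀ i < J, ∀ s ∈ Icc (σ i) (σ (i + 1)), (s, i) ∈ E ∩ (Icc 0 t ×ˢ Iic j) := by
    intro i hi s hs
    rw [hEq]
    simp only [mem_iUnion]
    exact ⟨i, hi, hs, rfl⟩
  have key : ∀ i < J, P (σ i) i → ∀ s ∈ Icc (σ i) (σ (i + 1)), P s i := by
    intro i hi hP s hs
    rcases hs.1.eq_or_lt with h | h
    · rwa [← h]
    · have h2 := hmem i hi s hs
      exact hflow i _ _ h h2.2.1.2 h2.2.2
        (fun r hr => (hmem i hi r ⟨hr.1, hr.2.trans hs.2⟩).1) hP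
  have hind : ∀ i < J, P (σ i) i := by
    intro i
    induction i with
    | zero => intro _; rwa [hσ0]
    | succ i ih =>
      intro hi
      have hi' : i < J := by omega
      exact hjump _ _ (hmem i hi' _ ⟨hmono i hi', le_rfl⟩).1
        (hmem (i + 1) hi _ ⟨le_rfl, hmono _ hi⟩).1
        (key i hi' (ih hi') _ ⟨hmono i hi', le_rfl⟩)
  have hmem' : (t, j) ∈ E ∩ (Icc 0 t ×ˢ Iic j) := ⟨htj, ⟨hE.1 _ htj, le_rfl⟩, le_refl j⟩
  rw [hEq] at hmem'
  simp only [mem_iUnion] at hmem'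
  obtain ⟨i, hi, hs, hij⟩ := hmem'
  obtain rfl : j = i := hij
  exact key j hi (hind j hi) t hs

theorem norm_le_inputSup {m : ℕ} {E : Set (ℝ × ℕ)} (hE : IsHTD E) {u : ℝ → Vec m}
    (hu : RegularInput u) {t s : ℝ} {j i : ℕ} (hs : (s, i) ∈ E) (hst : s ≤ t) (hij : i ≤ j) :
    ‖u s‖ ≤ inputSup E (fun t _ => u t) t j := by
  obtain ⟨M, hM⟩ := hu.bounded
  refine le_csSup ⟨M, ?_⟩ ⟨s, i, hs, hst, hij, rfl⟩
  rintro r ⟨s', i', hs', -, -, rfl⟩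
  exact hM _ (hE.1 _ hs')

theorem inputSup_nonneg {U : Type*} [NormedAddCommGroup U] (E : Set (ℝ × ℕ)) (u : ℝ → ℕ → U)
    (t : ℝ) (j : ℕ) : 0 ≤ inputSup E u t j := by
  refine Real.sSup_nonneg ?_
  rintro r ⟨s, i, -, -, -, rfl⟩
  exact norm_nonneg _

/-! ### Flows of the switching system -/

theorem modeVal_injective {N : ℕ} : Function.Injective (modeVal (N := N)) := by
  intro i o h
  simp only [modeVal, add_left_inj, Nat.cast_inj] at h
  exact Fin.ext h

/-- The mode is constant because `q` is absolutely continuous with derivative zero almost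
everywhere; the state constraints hold at every time because the flow set is closed. -/
theorem exists_mode_of_flow {n m N : ℕ} {f : Fin N → Vec n × Vec m × ℝ × ℝ → Vec n}
    {R : Fin N → Vec n → Vec n} {τd N₀ T : ℝ} {E : Set (ℝ × ℕ)} {x : ℝ → ℕ → Vec n}
    {τ q μ : ℝ → ℕ → ℝ} {u : ℝ → Vec m}
    (hsol : IsSolutionPair (switchingSystem f R τd N₀ T 1) E
      (fun t j => ((x t j, τ t j, q t j), μ t j)) (fun t _ => u t))
    {a b : ℝ} (hab : a < b) {j : ℕ} (hI : Icc a b ⊆ flowInterval E j) :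
    ∃ i : Fin N, (∀ t ∈ Icc a b, q t j = modeVal i ∧ τ t j ∈ Icc 0 N₀ ∧ 1 ≤ μ t j) ∧
      AbsolutelyContinuousOnInterval (fun t => (x t j, τ t j)) a b ∧
      AbsolutelyContinuousOnInterval (fun t => μ t j) a b ∧
      ∀ᵐ t, t ∈ Ioo a b → ∃ η ∈ Icc 0 (1 / τd),
        HasDerivAt (fun s => (x s j, τ s j)) (μ t j • (f i (x t j, u t, τ t j, μ t j), η)) t ∧
        HasDerivAt (fun s => μ s j) (μ t j ^ 2 / T) t := by
  have hint : (interior (flowInterval E j)).Nonempty :=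
    ⟨(a + b) / 2, mem_interior.2 ⟨Ioo a b, Ioo_subset_Icc_self.trans hI, isOpen_Ioo,
      ⟨by linarith, by linarith⟩⟩⟩
  have hac := hsol.arc j hint a b hab.le hI
  have hfl : ∀ᵐ t, t ∈ Ioo a b → ((x t j, τ t j, q t j), μ t j) ∈ (switchingSystem f R τd N₀ T 1).C ∧
      ∃ v ∈ (switchingSystem f R τd N₀ T 1).F ((x t j, τ t j, q t j), μ t j) (u t),
        HasDerivAt (fun s => ((x s j, τ s j, q s j), μ s j)) v t := by
    rw [← ae_restrict_iff' measurableSet_Ioo]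
    exact ae_mono (Measure.restrict_mono (Ioo_subset_Icc_self.trans hI) le_rfl) (hsol.flow j hint)
  have hcont := hac.continuousOn
  rw [uIcc_of_le hab.le] at hcont
  have hclosed : IsClosed (switchingSystem f R τd N₀ T 1).C :=
    ((isClosed_univ.prod (isClosed_Icc.prod (finite_range _).isClosed))).prod isClosed_Ici
  have hC := mem_of_ae_mem hab hcont hclosed (hfl.mono fun t h ht => (h ht).1)
  have comp : ∀ {Y : Type} [NormedAddCommGroup Y] [NormedSpace ℝ Y]
      (L : ((Vec n × ℝ × ℝ) × ℝ) →L[ℝ] Y),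
      AbsolutelyContinuousOnInterval (fun t => L ((x t j, τ t j, q t j), μ t j)) a b := by
    intro Y _ _ L
    exact absolutelyContinuousOnInterval_comp
      (L.lipschitz.locallyLipschitz.locallyLipschitzOn (s := univ)) hac (mapsTo_univ _ _)
  let Lq : ((Vec n × ℝ × ℝ) × ℝ) →L[ℝ] ℝ :=
    .comp (.snd ℝ ℝ ℝ) (.comp (.snd ℝ (Vec n) (ℝ × ℝ)) (.fst ℝ (Vec n × ℝ × ℝ) ℝ))
  let Lτ : ((Vec n × ℝ × ℝ) × ℝ) →L[ℝ] ℝ :=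
    .comp (.fst ℝ ℝ ℝ) (.comp (.snd ℝ (Vec n) (ℝ × ℝ)) (.fst ℝ (Vec n × ℝ × ℝ) ℝ))
  let Lx : ((Vec n × ℝ × ℝ) × ℝ) →L[ℝ] Vec n :=
    .comp (.fst ℝ (Vec n) (ℝ × ℝ)) (.fst ℝ (Vec n × ℝ × ℝ) ℝ)
  let Lμ : ((Vec n × ℝ × ℝ) × ℝ) →L[ℝ] ℝ := .snd ℝ (Vec n × ℝ × ℝ) ℝ
  obtain ⟨c, hc⟩ := (comp Lq).const_of_ae_hasDerivAt_zero (by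
    have hne : ∀ᵐ t : ℝ, t ≠ a ∧ t ≠ b :=
      (Measure.ae_ne volume a).and (Measure.ae_ne volume b)
    filter_upwards [hfl, hne] with t ht hne htI
    rw [uIcc_of_le hab.le] at htI
    obtain ⟨-, v, ⟨w, ⟨i, -, -, -, hw⟩, rfl⟩, hv⟩ :=
      ht ⟨lt_of_le_of_ne htI.1 (Ne.symm hne.1), lt_of_le_of_ne htI.2 hne.2⟩
    have h := Lq.hasFDerivAt.comp_hasDerivAt t hv
    have h0 : Lq (μ t j • w, 1 / T * μ t j ^ (1 + 1 / 1 : ℝ)) = 0 := by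
      simp [Lq, hw]
    rw [← h0]
    exact h)
  rw [uIcc_of_le hab.le] at hc
  obtain ⟨⟨-, -, i, hi⟩, -⟩ := hC a (left_mem_Icc.2 hab.le)
  have hca : q a j = c := hc a (left_mem_Icc.2 hab.le)
  have hq : ∀ t ∈ Icc a b, q t j = modeVal i := fun t ht => by
    have h1 : q t j = c := hc t ht
    rw [h1, ← hca]
    exact hi.symm
  refine ⟨i, fun t ht => ⟨hq t ht, (hC t ht).1.2.1, (hC t ht).2⟩, comp (Lx.prod Lτ), comp Lμ, ?_⟩
  filter_upwards [hfl] with t ht htI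
  obtain ⟨-, v, ⟨w, ⟨i', hi', hw1, hw2, hw3⟩, rfl⟩, hv⟩ := ht htI
  obtain rfl : i' = i := modeVal_injective (hi'.symm.trans (hq t (Ioo_subset_Icc_self htI)))
  refine ⟨w.2.1, hw2, ?_, ?_⟩
  · have h := (Lx.prod Lτ).hasFDerivAt.comp_hasDerivAt t hv
    have h0 : (Lx.prod Lτ) (μ t j • w, 1 / T * μ t j ^ (1 + 1 / 1 : ℝ)) =
        μ t j • (f i' (x t j, u t, τ t j, μ t j), w.2.1) := by
      simp only [← hw1]
      simp [Lx, Lτ]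
    rw [← h0]
    exact h
  · have h := Lμ.hasFDerivAt.comp_hasDerivAt t hv
    have h0 : Lμ (μ t j • w, 1 / T * μ t j ^ (1 + 1 / 1 : ℝ)) = μ t j ^ 2 / T := by
      have h2 : (1 + 1 / 1 : ℝ) = (2 : ℕ) := by norm_num
      rw [h2, Real.rpow_natCast]
      simp [Lμ]
      ring
    rw [← h0]
    exact h

/-! ### Monotone quantities during flows -/

theorem absolutelyContinuousOnInterval_rpow {g : ℝ → ℝ} {a b : ℝ} (r : ℝ)
    (hg : AbsolutelyContinuousOnInterval g a b) (h1 : ∀ t ∈ uIcc a b, 1 ≤ g t) :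
    AbsolutelyContinuousOnInterval (fun t => g t ^ r) a b := by
  refine absolutelyContinuousOnInterval_comp (S := Ici 1) (F := fun y : ℝ => y ^ r)
    (locallyLipschitzOn_of_contDiffOn (convex_Ici 1) fun y hy => ?_) hg h1
  exact (Real.contDiffAt_rpow_const_of_ne (zero_lt_one.trans_le hy).ne').contDiffWithinAt

theorem absolutelyContinuousOnInterval_log {g : ℝ → ℝ} {a b : ℝ}
    (hg : AbsolutelyContinuousOnInterval g a b) (h1 : ∀ t ∈ uIcc a b, 1 ≤ g t) :
    AbsolutelyContinuousOnInterval (fun t => Real.log (g t)) a b := by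
  refine absolutelyContinuousOnInterval_comp (S := Ici 1) (F := Real.log)
    (locallyLipschitzOn_of_contDiffOn (convex_Ici 1) fun y hy => ?_) hg h1
  exact (Real.contDiffAt_log.2 (zero_lt_one.trans_le hy).ne').contDiffWithinAt

theorem absolutelyContinuousOnInterval_const {X : Type*} [PseudoMetricSpace X] (c : X) (a b : ℝ) :
    AbsolutelyContinuousOnInterval (fun _ => c) a b := by
  simpa [AbsolutelyContinuousOnInterval] using tendsto_const_nhds

/-- If `v̇ ≤ μ (-c v + d)` with `μ ^ a d ≤ c M / 2` and `μ̇ = μ² / T`, then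
`(μ ^ a v - M) μ ^ (c T / 2)` is nonincreasing as long as `a ≤ c T / 2`. -/
theorem weighted_le_of_flow {v μ : ℝ → ℝ} {s₀ s₁ T a c M : ℝ} (hs : s₀ ≤ s₁) (hT : 0 < T)
    (hac : a ≤ c * T / 2)
    (hv : AbsolutelyContinuousOnInterval v s₀ s₁) (hμ : AbsolutelyContinuousOnInterval μ s₀ s₁)
    (hv0 : ∀ t ∈ Icc s₀ s₁, 0 ≤ v t) (hμ1 : ∀ t ∈ Icc s₀ s₁, 1 ≤ μ t)
    (hd : ∀ᵐ t, t ∈ Ioo s₀ s₁ → HasDerivAt μ (μ t ^ 2 / T) t ∧ ∃ w d, HasDerivAt v w t ∧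
      w ≤ μ t * (-c * v t + d) ∧ μ t ^ a * d ≤ c * M / 2) :
    (μ s₁ ^ a * v s₁ - M) * μ s₁ ^ (c * T / 2) ≤ (μ s₀ ^ a * v s₀ - M) * μ s₀ ^ (c * T / 2) := by
  have hμ1' : ∀ t ∈ uIcc s₀ s₁, 1 ≤ μ t := by rwa [uIcc_of_le hs]
  refine le_of_ae_hasDerivAt_nonpos (g := fun t => (μ t ^ a * v t - M) * μ t ^ (c * T / 2)) hs
    ((((absolutelyContinuousOnInterval_rpow a hμ hμ1').fun_mul hv).fun_sub
      (absolutelyContinuousOnInterval_const M _ _)).fun_mul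
      (absolutelyContinuousOnInterval_rpow _ hμ hμ1')) ?_
  filter_upwards [hd] with t ht htI
  obtain ⟨hdμ, w, d, hdv, hw, hda⟩ := ht htI
  have hμt : 1 ≤ μ t := hμ1 t (Ioo_subset_Icc_self htI)
  have hvt : 0 ≤ v t := hv0 t (Ioo_subset_Icc_self htI)
  have hpos : 0 < μ t := by linarith
  refine ⟨_, ?_, (((hdμ.rpow_const (p := a) (Or.inl hpos.ne')).mul hdv).sub_const M).mul
    (hdμ.rpow_const (p := c * T / 2) (Or.inl hpos.ne'))⟩
  have e : ∀ r : ℝ, μ t ^ (r - 1) = μ t ^ r / μ t := fun r => Real.rpow_sub_one hpos.ne' r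
  simp only [e, Pi.mul_apply]
  have hA : 0 < μ t ^ a := Real.rpow_pos_of_pos hpos a
  have hB : 0 < μ t ^ (c * T / 2) := Real.rpow_pos_of_pos hpos _
  -- The common factor `μ ^ (c * T / 2)` is pulled out; after inserting the bound on `w`, the
  -- coefficient of `μ * (μ ^ a * v)` is `a / T - c / 2 ≤ 0`.
  have key : (μ t ^ 2 / T * a * (μ t ^ a / μ t) * v t + μ t ^ a * w) * μ t ^ (c * T / 2) +
      (μ t ^ a * v t - M) * (μ t ^ 2 / T * (c * T / 2) * (μ t ^ (c * T / 2) / μ t)) =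
      μ t ^ (c * T / 2) * ((a / T + c / 2) * (μ t * (μ t ^ a * v t)) + μ t ^ a * w
        - μ t * (c * M / 2)) := by
    field_simp
    ring
  rw [key]
  refine mul_nonpos_of_nonneg_of_nonpos hB.le ?_
  have h1 : a / T ≤ c / 2 := by
    rw [div_le_iff₀ hT]
    linarith
  have h2 : 0 ≤ (c / 2 - a / T) * (μ t * (μ t ^ a * v t)) :=
    mul_nonneg (by linarith) (by positivity)
  have h3 := mul_le_mul_of_nonneg_left hw hA.le
  have h4 := mul_le_mul_of_nonneg_left hda hpos.le
  nlinarith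

theorem sub_log_le_of_flow {τ μ : ℝ → ℝ} {s₀ s₁ T τd : ℝ} (hs : s₀ ≤ s₁) (hT : 0 < T)
    (hτd : 0 < τd) (hτ : AbsolutelyContinuousOnInterval τ s₀ s₁)
    (hμ : AbsolutelyContinuousOnInterval μ s₀ s₁) (hμ1 : ∀ t ∈ Icc s₀ s₁, 1 ≤ μ t)
    (hd : ∀ᵐ t, t ∈ Ioo s₀ s₁ → HasDerivAt μ (μ t ^ 2 / T) t ∧
      ∃ η ≤ 1 / τd, HasDerivAt τ (μ t * η) t) :
    τd * τ s₁ - T * Real.log (μ s₁) ≤ τd * τ s₀ - T * Real.log (μ s₀) := by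
  have hμ1' : ∀ t ∈ uIcc s₀ s₁, 1 ≤ μ t := by rwa [uIcc_of_le hs]
  refine le_of_ae_hasDerivAt_nonpos (g := fun t => τd * τ t - T * Real.log (μ t)) hs
    ((hτ.const_mul τd).fun_sub ((absolutelyContinuousOnInterval_log hμ hμ1').const_mul T)) ?_
  filter_upwards [hd] with t ht htI
  obtain ⟨hdμ, η, hη, hdτ⟩ := ht htI
  have hpos : 0 < μ t := by linarith [hμ1 t (Ioo_subset_Icc_self htI)]
  refine ⟨_, ?_, (hdτ.const_mul τd).sub ((hdμ.log hpos.ne').const_mul T)⟩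
  rw [le_div_iff₀ hτd] at hη
  have h1 : τd * (μ t * η) - T * (μ t ^ 2 / T / μ t) = μ t * (η * τd - 1) := by
    field_simp
  rw [h1]
  exact mul_nonpos_of_nonneg_of_nonpos hpos.le (by linarith)

theorem le_of_blowUp_flow {μ : ℝ → ℝ} {s₀ s₁ T : ℝ} (hs : s₀ ≤ s₁) (hT : 0 < T)
    (hμ : AbsolutelyContinuousOnInterval μ s₀ s₁)
    (hd : ∀ᵐ t, t ∈ Ioo s₀ s₁ → HasDerivAt μ (μ t ^ 2 / T) t) : μ s₀ ≤ μ s₁ := by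
  have h := le_of_ae_hasDerivAt_nonpos (g := fun t => -μ t) hs hμ.fun_neg (by
    filter_upwards [hd] with t ht htI
    exact ⟨_, neg_nonpos.2 (by positivity), (ht htI).neg⟩)
  exact neg_le_neg_iff.1 h

/-! ### The Lyapunov function along solutions -/

/-- `V` is smooth only for `τ ≥ 0`, so the chain rule is applied within that set; as the timer stays
admissible near `t`, the result is a genuine derivative in time, even if `τ = 0`. -/
theorem hasDerivAt_lyapunov_of_flow {n m N : ℕ} {f : Fin N → Vec n × Vec m × ℝ × ℝ → Vec n}
    {R : Fin N → Vec n → Vec n} {Δ : ℝ → ℝ} {τd N₀ p : ℝ} {V : Fin N → Vec n × ℝ → ℝ}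
    {c₁ c₂ c₃ c₄ : Fin N → ℝ} (hL : LyapunovConditions f R Δ τd N₀ p V c₁ c₂ c₃ c₄)
    (i : Fin N) {y : ℝ → Vec n × ℝ} {w : Vec m} {t μ η : ℝ} (hμ : 1 ≤ μ)
    (hη : η ∈ Icc 0 (1 / τd)) (hy : ∀ᶠ s in 𝓝 t, (y s).2 ∈ Icc 0 N₀)
    (hd : HasDerivAt y (μ • (f i ((y t).1, w, (y t).2, μ), η)) t) :
    ∃ v, HasDerivAt (fun s => V i (y s)) v t ∧
      v ≤ μ * (-c₃ i * V i (y t) + c₄ i * Δ μ * ‖w‖ ^ p) := by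
  have hyt : (y t).2 ∈ Icc 0 N₀ := hy.self_of_nhds
  have hS : y t ∈ (univ ×ˢ Ici 0 : Set (Vec n × ℝ)) := ⟨mem_univ _, hyt.1⟩
  have hVd : HasFDerivWithinAt (V i) (fderivWithin ℝ (V i) (univ ×ˢ Ici 0) (y t))
      (univ ×ˢ Ici 0) (y t) :=
    (((hL.smooth i).differentiableOn (by simp)) _ hS).hasFDerivWithinAt
  have hU : {s | (y s).2 ∈ Icc 0 N₀} ∈ 𝓝 t := hy
  have hc := (hVd.comp_hasDerivWithinAt t (hd.hasDerivWithinAt (s := {s | (y s).2 ∈ Icc 0 N₀}))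
    (fun s hs => ⟨mem_univ _, hs.1⟩)).hasDerivAt hU
  refine ⟨_, hc, ?_⟩
  rw [map_smul, smul_eq_mul]
  exact mul_le_mul_of_nonneg_left (hL.decrease i (y t).1 w (y t).2 hyt μ hμ η hη) (by linarith)

/-- The invariant at a point of the hybrid time domain: bounds on the state, the weighted
Lyapunov function, and the timer. -/
def Invariant {n N : ℕ} (V : Fin N → Vec n × ℝ → ℝ) (τd N₀ T a c M Φ₀ L₀ μ₀ : ℝ) (j : ℕ)
    (x : Vec n) (τ q μ : ℝ) : Prop :=
  ∃ i : Fin N, q = modeVal i ∧ τ ∈ Icc 0 N₀ ∧ μ₀ ≤ μ ∧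
    (μ ^ a * V i (x, τ) - M) * μ ^ (c * T / 2) ≤ Φ₀ ∧
    τd * (τ + j) - T * Real.log μ ≤ L₀

theorem invariant_of_flow {n m N : ℕ} {f : Fin N → Vec n × Vec m × ℝ × ℝ → Vec n}
    {R : Fin N → Vec n → Vec n} {Δ : ℝ → ℝ} {τd N₀ p : ℝ} {V : Fin N → Vec n × ℝ → ℝ}
    {c₁ c₂ c₃ c₄ : Fin N → ℝ} (hL : LyapunovConditions f R Δ τd N₀ p V c₁ c₂ c₃ c₄)
    {T a c C D U Φ₀ L₀ μ₀ : ℝ} (hτd : 0 < τd) (hT : 0 < T) (hc : 0 < c) (hc₃ : ∀ i, c ≤ c₃ i)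
    (hc₄ : ∀ i, c₄ i ≤ C) (hac : a ≤ c * T / 2) (hΔ : ∀ μ, 1 ≤ μ → 0 ≤ Δ μ ∧ μ ^ a * Δ μ ≤ D)
    (hC : 0 < C)
    {E : Set (ℝ × ℕ)} {x : ℝ → ℕ → Vec n} {τ q μ : ℝ → ℕ → ℝ} {u : ℝ → Vec m}
    (hsol : IsSolutionPair (switchingSystem f R τd N₀ T 1) E
      (fun t j => ((x t j, τ t j, q t j), μ t j)) (fun t _ => u t))
    {s₀ s₁ : ℝ} (hs : s₀ < s₁) {j : ℕ} (hI : Icc s₀ s₁ ⊆ flowInterval E j)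
    (hU : ∀ s ∈ Icc s₀ s₁, ‖u s‖ ^ p ≤ U)
    (h : Invariant V τd N₀ T a c (2 * C * D * U / c) Φ₀ L₀ μ₀ j
      (x s₀ j) (τ s₀ j) (q s₀ j) (μ s₀ j)) :
    Invariant V τd N₀ T a c (2 * C * D * U / c) Φ₀ L₀ μ₀ j
      (x s₁ j) (τ s₁ j) (q s₁ j) (μ s₁ j) := by
  obtain ⟨i', hi', hτ', hμ', hΦ', hL'⟩ := h
  obtain ⟨i, hst, hxτ, hμ, hd⟩ := exists_mode_of_flow hsol hs hI
  have hl := left_mem_Icc.2 hs.le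
  have hr := right_mem_Icc.2 hs.le
  obtain rfl : i' = i := modeVal_injective (hi'.symm.trans (hst s₀ hl).1)
  have hμ1 : ∀ t ∈ Icc s₀ s₁, 1 ≤ μ t j := fun t ht => (hst t ht).2.2
  have hτac : AbsolutelyContinuousOnInterval (fun t => τ t j) s₀ s₁ :=
    absolutelyContinuousOnInterval_comp (g := fun t => (x t j, τ t j)) (S := univ) (F := Prod.snd)
      (LipschitzWith.prod_snd.locallyLipschitz.locallyLipschitzOn) hxτ (mapsTo_univ _ _)
  have hVac : AbsolutelyContinuousOnInterval (fun t => V i' (x t j, τ t j)) s₀ s₁ := by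
    have hconv : Convex ℝ (univ ×ˢ Ici 0 : Set (Vec n × ℝ)) := convex_univ.prod (convex_Ici 0)
    have hlip : LocallyLipschitzOn (univ ×ˢ Ici 0 : Set (Vec n × ℝ)) (V i') :=
      locallyLipschitzOn_of_contDiffOn hconv ((hL.smooth i').of_le (by simp))
    have hmaps : MapsTo (fun t => (x t j, τ t j)) (uIcc s₀ s₁) (univ ×ˢ Ici 0) := fun t ht => by
      rw [uIcc_of_le hs.le] at ht
      exact ⟨mem_univ _, (hst t ht).2.1.1⟩
    exact absolutelyContinuousOnInterval_comp hlip hxτ hmaps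
  refine ⟨i', (hst s₁ hr).1, (hst s₁ hr).2.1, hμ'.trans ?_, le_trans ?_ hΦ', ?_⟩
  · refine le_of_blowUp_flow (μ := fun t => μ t j) hs.le hT hμ ?_
    filter_upwards [hd] with t ht htI
    obtain ⟨η, -, -, h2⟩ := ht htI
    exact h2
  · refine weighted_le_of_flow (v := fun t => V i' (x t j, τ t j)) (μ := fun t => μ t j) hs.le hT
      hac hVac hμ (fun t ht => hL.nonneg _ _ _ (hst t ht).2.1.1) hμ1 ?_
    filter_upwards [hd] with t ht htI
    obtain ⟨η, hη, h1, h2⟩ := ht htI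
    have htI' := Ioo_subset_Icc_self htI
    obtain ⟨v, hv, hvle⟩ := hasDerivAt_lyapunov_of_flow hL i' (hμ1 t htI') hη
      (y := fun s => (x s j, τ s j)) (w := u t) (by
        filter_upwards [Ioo_mem_nhds htI.1 htI.2] with s hs'
        exact (hst s (Ioo_subset_Icc_self hs')).2.1) h1
    have hV0 : 0 ≤ V i' (x t j, τ t j) := hL.nonneg _ _ _ (hst t htI').2.1.1
    have hμt := hμ1 t htI'
    obtain ⟨hΔ0, hΔD⟩ := hΔ _ hμt
    have hu0 : 0 ≤ ‖u t‖ ^ p := by positivity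
    refine ⟨h2, v, C * Δ (μ t j) * ‖u t‖ ^ p, hv, hvle.trans ?_, ?_⟩
    · have h3 : -c₃ i' * V i' (x t j, τ t j) ≤ -c * V i' (x t j, τ t j) :=
        mul_le_mul_of_nonneg_right (neg_le_neg (hc₃ i')) hV0
      have h4 : c₄ i' * Δ (μ t j) * ‖u t‖ ^ p ≤ C * Δ (μ t j) * ‖u t‖ ^ p := by
        have := hc₄ i'
        gcongr
      have h5 : 0 ≤ μ t j := by linarith
      exact mul_le_mul_of_nonneg_left (add_le_add h3 h4) h5
    -- The offset `2 * C * D * U / c` is chosen so that half the decay rate times it equals the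
    -- largest weighted input term.
    · have h3 : c * (2 * C * D * U / c) / 2 = C * (D * U) := by field_simp
      have h4 : 0 ≤ μ t j ^ a * Δ (μ t j) := mul_nonneg (by positivity) hΔ0
      calc μ t j ^ a * (C * Δ (μ t j) * ‖u t‖ ^ p)
          = C * ((μ t j ^ a * Δ (μ t j)) * ‖u t‖ ^ p) := by ring
        _ ≤ C * (D * U) := by
          refine mul_le_mul_of_nonneg_left ?_ hC.le
          exact mul_le_mul hΔD (hU t htI') hu0 (h4.trans hΔD)
        _ = _ := h3.symm
  · have h3 := sub_log_le_of_flow (τ := fun t => τ t j) (μ := fun t => μ t j) hs.le hT hτd hτac hμ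
      hμ1 (by
        filter_upwards [hd] with t ht htI
        obtain ⟨η, hη, h1, h2⟩ := ht htI
        refine ⟨h2, η, hη.2, ?_⟩
        exact (ContinuousLinearMap.snd ℝ (Vec n) ℝ).hasFDerivAt.comp_hasDerivAt t h1)
    linarith

theorem invariant_of_jump {n m N : ℕ} {f : Fin N → Vec n × Vec m × ℝ × ℝ → Vec n}
    {R : Fin N → Vec n → Vec n} {Δ : ℝ → ℝ} {τd N₀ p : ℝ} {V : Fin N → Vec n × ℝ → ℝ}
    {c₁ c₂ c₃ c₄ : Fin N → ℝ} (hL : LyapunovConditions f R Δ τd N₀ p V c₁ c₂ c₃ c₄)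
    {T a c M Φ₀ L₀ μ₀ : ℝ} (hμ₀ : 1 ≤ μ₀)
    {E : Set (ℝ × ℕ)} {x : ℝ → ℕ → Vec n} {τ q μ : ℝ → ℕ → ℝ} {u : ℝ → Vec m}
    (hsol : IsSolutionPair (switchingSystem f R τd N₀ T 1) E
      (fun t j => ((x t j, τ t j, q t j), μ t j)) (fun t _ => u t))
    {s : ℝ} {j : ℕ} (hj : (s, j) ∈ E) (hj' : (s, j + 1) ∈ E)
    (h : Invariant V τd N₀ T a c M Φ₀ L₀ μ₀ j (x s j) (τ s j) (q s j) (μ s j)) :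
    Invariant V τd N₀ T a c M Φ₀ L₀ μ₀ (j + 1)
      (x s (j + 1)) (τ s (j + 1)) (q s (j + 1)) (μ s (j + 1)) := by
  obtain ⟨i', hi', hτ', hμ', hΦ', hL'⟩ := h
  obtain ⟨⟨⟨-, hτ1, -⟩, -⟩, ⟨i, o, hi, hoi, hG⟩, hμe⟩ := hsol.jump s j hj hj'
  obtain rfl : i' = i := modeVal_injective (hi'.symm.trans hi)
  simp only [Prod.mk.injEq] at hG
  obtain ⟨hx, hτ, hq⟩ := hG
  have hμe' : μ s (j + 1) = μ s j := hμe
  obtain ⟨χ, -, hχ1, hχ⟩ := hL.reset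
  have hV := hχ i' o hoi (x s j) (τ s j) hτ1
  have hV0 : 0 ≤ V i' (x s j, τ s j) := hL.nonneg _ _ _ hτ'.1
  have hpos : 0 < μ s j := by linarith
  refine ⟨o, hq, ?_, by rwa [hμe'], ?_, ?_⟩
  · rw [hτ]
    exact ⟨by linarith [hτ1.1], by linarith [hτ'.2]⟩
  · rw [hμe', hx, hτ]
    refine le_trans ?_ hΦ'
    have hV' : V o (R i' (x s j), τ s j - 1) ≤ V i' (x s j, τ s j) := by nlinarith
    gcongr
  · rw [hμe', hτ]
    push_cast
    linarith

/-! ### The exponential estimate -/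

/-- The sum is at most twice its larger term, which avoids any convexity and covers `p < 1` as well.
-/
theorem le_add_of_rpow_le {p A B X Y Z : ℝ} (hp : 0 < p) (hA : 0 ≤ A) (hB : 0 ≤ B) (hX : 0 ≤ X)
    (hY : 0 ≤ Y) (hZ : 0 ≤ Z) (h : X ^ p ≤ A * Y ^ p + B * Z ^ p) :
    X ≤ (2 * A) ^ (1 / p) * Y + (2 * B) ^ (1 / p) * Z := by
  have key : ∀ G W : ℝ, 0 ≤ G → 0 ≤ W → X ^ p ≤ 2 * (G * W ^ p) → X ≤ (2 * G) ^ (1 / p) * W := by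
    intro G W hG hW hGW
    have h1 : (2 * G) ^ (1 / p) * W = (2 * (G * W ^ p)) ^ (1 / p) := by
      rw [← mul_assoc, Real.mul_rpow (x := 2 * G) (by positivity) (by positivity),
        ← Real.rpow_mul hW,
        mul_one_div_cancel hp.ne', Real.rpow_one]
    have h2 : X = (X ^ p) ^ (1 / p) := by
      rw [← Real.rpow_mul hX, mul_one_div_cancel hp.ne', Real.rpow_one]
    rw [h1, h2]
    exact Real.rpow_le_rpow (by positivity) hGW (by positivity)
  have h3 : 0 ≤ (2 * A) ^ (1 / p) * Y := by positivity
  have h4 : 0 ≤ (2 * B) ^ (1 / p) * Z := by positivity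
  rcases le_total (A * Y ^ p) (B * Z ^ p) with h' | h'
  · linarith [key B Z hB hZ (by linarith)]
  · linarith [key A Y hA hY (by linarith)]

theorem rpow_le_and_timer_of_solution {n m N : ℕ} {f : Fin N → Vec n × Vec m × ℝ × ℝ → Vec n}
    {R : Fin N → Vec n → Vec n} {Δ : ℝ → ℝ} {τd N₀ p : ℝ} {V : Fin N → Vec n × ℝ → ℝ}
    {c₁ c₂ c₃ c₄ : Fin N → ℝ} (hL : LyapunovConditions f R Δ τd N₀ p V c₁ c₂ c₃ c₄)
    {T a b₁ b₂ c C D : ℝ} (hτd : 0 < τd) (hT : 0 < T) (hc : 0 < c) (hC : 0 < C) (hb₁ : 0 < b₁)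
    (hc₁ : ∀ i, b₁ ≤ c₁ i) (hc₂ : ∀ i, c₂ i ≤ b₂) (hc₃ : ∀ i, c ≤ c₃ i)
    (hc₄ : ∀ i, c₄ i ≤ C) (hac : a ≤ c * T / 2) (hD : 0 ≤ D)
    (hΔ : ∀ μ, 1 ≤ μ → 0 ≤ Δ μ ∧ μ ^ a * Δ μ ≤ D)
    {E : Set (ℝ × ℕ)} {x : ℝ → ℕ → Vec n} {τ q μ : ℝ → ℕ → ℝ} {u : ℝ → Vec m}
    (hu : RegularInput u)
    (hsol : IsSolutionPair (switchingSystem f R τd N₀ T 1) E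
      (fun t j => ((x t j, τ t j, q t j), μ t j)) (fun t _ => u t))
    {t : ℝ} {j : ℕ} (htj : (t, j) ∈ E) :
    1 ≤ μ 0 0 ∧ μ 0 0 ≤ μ t j ∧
      τd * (j - N₀) ≤ T * Real.log (μ t j / μ 0 0) ∧
      ‖x t j‖ ^ p ≤ b₂ / b₁ * (μ 0 0 / μ t j) ^ (a + c * T / 2) * ‖x 0 0‖ ^ p
        + 2 * C / (c * b₁) * D * (μ t j ^ a)⁻¹ * inputSup E (fun t _ => u t) t j ^ p := by
  have hp := hL.exponent_pos
  set S := inputSup E (fun t _ => u t) t j with hS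
  have hS0 : 0 ≤ S := inputSup_nonneg _ _ _ _
  set M := 2 * C * D * S ^ p / c with hM
  have hM0 : 0 ≤ M := by positivity
  have hinit : (∃ i : Fin N, q 0 0 = modeVal i) ∧ τ 0 0 ∈ Icc 0 N₀ ∧ 1 ≤ μ 0 0 := by
    rcases hsol.init with ⟨⟨-, h1, i, hi⟩, h2⟩ | ⟨⟨-, h1, i, hi⟩, h2⟩
    · exact ⟨⟨i, hi.symm⟩, h1, h2⟩
    · exact ⟨⟨i, hi.symm⟩, ⟨zero_le_one.trans h1.1, h1.2⟩, h2⟩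
  obtain ⟨⟨i₀, hi₀⟩, hτ₀, hμ₀⟩ := hinit
  have hinv : Invariant V τd N₀ T a c M ((μ 0 0 ^ a * V i₀ (x 0 0, τ 0 0) - M) *
      μ 0 0 ^ (c * T / 2)) (τd * (τ 0 0 + (0 : ℕ)) - T * Real.log (μ 0 0)) (μ 0 0) j
      (x t j) (τ t j) (q t j) (μ t j) := by
    refine hsol.htd.induction (P := fun s i => Invariant V τd N₀ T a c M _ _ (μ 0 0) i
      (x s i) (τ s i) (q s i) (μ s i)) htj ⟨i₀, hi₀, hτ₀, le_rfl, le_rfl, le_rfl⟩ ?_ ?_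
    · intro i s₀ s₁ hs hst hij hI hP
      refine invariant_of_flow hL hτd hT hc hc₃ hc₄ hac hΔ hC hsol hs hI (fun s hs' => ?_) hP
      exact Real.rpow_le_rpow (norm_nonneg _)
        (norm_le_inputSup hsol.htd hu (hI hs') (hs'.2.trans hst) hij) hp.le
    · intro s i h1 h2 hP
      exact invariant_of_jump hL hμ₀ hsol h1 h2 hP
  obtain ⟨i, -, hτ, hμ, hΦ, hlog⟩ := hinv
  have hpos₀ : 0 < μ 0 0 := by linarith
  have hpos : 0 < μ t j := by linarith
  refine ⟨hμ₀, hμ, ?_, ?_⟩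
  · rw [Real.log_div hpos.ne' hpos₀.ne']
    push_cast at hlog
    have h1 := mul_le_mul_of_nonneg_left hτ₀.2 hτd.le
    have h2 := mul_nonneg hτd.le hτ.1
    linarith
  · have hVlow : b₁ * ‖x t j‖ ^ p ≤ V i (x t j, τ t j) :=
      (mul_le_mul_of_nonneg_right (hc₁ i) (by positivity)).trans (hL.bounds i _ _ hτ).1
    have hVup : V i₀ (x 0 0, τ 0 0) ≤ b₂ * ‖x 0 0‖ ^ p :=
      (hL.bounds i₀ _ _ hτ₀).2.trans (mul_le_mul_of_nonneg_right (hc₂ i₀) (by positivity))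
    rw [Real.div_rpow hpos₀.le hpos.le, Real.rpow_add hpos₀, Real.rpow_add hpos]
    set A₀ := μ 0 0 ^ a
    set B₀ := μ 0 0 ^ (c * T / 2)
    set A := μ t j ^ a
    set B := μ t j ^ (c * T / 2)
    have hA₀ : 0 < A₀ := Real.rpow_pos_of_pos hpos₀ _
    have hB₀ : 0 < B₀ := Real.rpow_pos_of_pos hpos₀ _
    have hA : 0 < A := Real.rpow_pos_of_pos hpos _
    have hB : 0 < B := Real.rpow_pos_of_pos hpos _
    -- The offset is dropped on the initial side, where it helps, and becomes the input term on the
    -- final side.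
    have h1 : (A * (b₁ * ‖x t j‖ ^ p) - M) * B ≤ A₀ * (b₂ * ‖x 0 0‖ ^ p) * B₀ :=
      calc (A * (b₁ * ‖x t j‖ ^ p) - M) * B ≤ (A * V i (x t j, τ t j) - M) * B := by gcongr
        _ ≤ (A₀ * V i₀ (x 0 0, τ 0 0) - M) * B₀ := hΦ
        _ ≤ (A₀ * (b₂ * ‖x 0 0‖ ^ p) - 0) * B₀ := by gcongr
        _ = _ := by ring
    have h2 : b₂ / b₁ * (A₀ * B₀ / (A * B)) * ‖x 0 0‖ ^ p + 2 * C / (c * b₁) * D * A⁻¹ * S ^ p =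
        (A₀ * (b₂ * ‖x 0 0‖ ^ p) * B₀ + M * B) / (A * B * b₁) := by
      rw [hM]
      field_simp
    rw [h2, le_div_iff₀ (by positivity)]
    linarith

theorem norm_le_of_solution {n m N : ℕ} {f : Fin N → Vec n × Vec m × ℝ × ℝ → Vec n}
    {R : Fin N → Vec n → Vec n} {Δ : ℝ → ℝ} {τd N₀ p : ℝ} {V : Fin N → Vec n × ℝ → ℝ}
    {c₁ c₂ c₃ c₄ : Fin N → ℝ} (hL : LyapunovConditions f R Δ τd N₀ p V c₁ c₂ c₃ c₄)
    {T a b₁ b₂ c C D : ℝ} (hτd : 0 < τd) (hT : 0 < T) (hc : 0 < c) (hC : 0 < C) (hb₁ : 0 < b₁)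
    (hb₂ : 0 < b₂)
    (hc₁ : ∀ i, b₁ ≤ c₁ i) (hc₂ : ∀ i, c₂ i ≤ b₂) (hc₃ : ∀ i, c ≤ c₃ i)
    (hc₄ : ∀ i, c₄ i ≤ C) (hac : a ≤ c * T / 2) (hD : 0 ≤ D)
    (hΔ : ∀ μ, 1 ≤ μ → 0 ≤ Δ μ ∧ μ ^ a * Δ μ ≤ D)
    {E : Set (ℝ × ℕ)} {x : ℝ → ℕ → Vec n} {τ q μ : ℝ → ℕ → ℝ} {u : ℝ → Vec m}
    (hu : RegularInput u)
    (hsol : IsSolutionPair (switchingSystem f R τd N₀ T 1) E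
      (fun t j => ((x t j, τ t j, q t j), μ t j)) (fun t _ => u t))
    {t : ℝ} {j : ℕ} (htj : (t, j) ∈ E) :
    1 ≤ μ 0 0 ∧ μ 0 0 ≤ μ t j ∧
      ‖x t j‖ ≤ (2 * (b₂ / b₁)) ^ (1 / p) * Real.exp (c * τd / (4 * p) * N₀) *
          (μ 0 0 / μ t j) ^ (a / p + c * T / (4 * p)) * Real.exp (-(c * τd / (4 * p)) * j) * ‖x 0 0‖
        + (4 * C / (c * b₁)) ^ (1 / p) * D ^ (1 / p) / μ t j ^ (a / p) *
          inputSup E (fun t _ => u t) t j := by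
  obtain ⟨h1, h2, h3, h4⟩ := rpow_le_and_timer_of_solution hL hτd hT hc hC hb₁ hc₁ hc₂ hc₃ hc₄
    hac hD hΔ hu hsol htj
  have hp := hL.exponent_pos
  have hpos₀ : 0 < μ 0 0 := by linarith
  have hpos : 0 < μ t j := by linarith
  have hρ : 0 < μ 0 0 / μ t j := by positivity
  refine ⟨h1, h2, (le_add_of_rpow_le hp (by positivity) (by positivity) (norm_nonneg _)
    (norm_nonneg _) (inputSup_nonneg _ _ _ _) h4).trans (add_le_add ?_ (le_of_eq ?_))⟩
  · refine mul_le_mul_of_nonneg_right ?_ (norm_nonneg _)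
    rw [← mul_assoc, Real.mul_rpow (by positivity) (by positivity), ← Real.rpow_mul hρ.le]
    -- The last summand of the exponent is spent on the decay in `j`; the rest remains as decay in
    -- `μ₀ / μ`.
    have e1 : (a + c * T / 2) * (1 / p) = (a / p + c * T / (4 * p)) + c * T / (4 * p) := by
      field_simp
      ring
    have e2 : (μ 0 0 / μ t j) ^ (c * T / (4 * p)) ≤
        Real.exp (c * τd / (4 * p) * N₀) * Real.exp (-(c * τd / (4 * p)) * j) := by
      rw [Real.rpow_def_of_pos hρ, ← Real.exp_add, Real.exp_le_exp]
      have e3 : Real.log (μ 0 0 / μ t j) = -Real.log (μ t j / μ 0 0) := by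
        rw [← Real.log_inv, inv_div]
      have e4 := mul_le_mul_of_nonneg_left h3 (show 0 ≤ c / (4 * p) by positivity)
      have e5 : c / (4 * p) * (τd * (j - N₀)) =
          -(c * τd / (4 * p) * N₀ + -(c * τd / (4 * p)) * j) := by ring
      have e6 : c / (4 * p) * (T * Real.log (μ t j / μ 0 0)) =
          Real.log (μ t j / μ 0 0) * (c * T / (4 * p)) := by ring
      rw [e3]
      linarith
    rw [e1, Real.rpow_add hρ]
    calc _ ≤ (2 * (b₂ / b₁)) ^ (1 / p) * ((μ 0 0 / μ t j) ^ (a / p + c * T / (4 * p)) *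
          (Real.exp (c * τd / (4 * p) * N₀) * Real.exp (-(c * τd / (4 * p)) * j))) := by gcongr
      _ = _ := by ring
  · have e1 : 2 * (2 * C / (c * b₁) * D * (μ t j ^ a)⁻¹) = 4 * C / (c * b₁) * D * (μ t j ^ a)⁻¹ := by
      ring
    rw [e1, Real.mul_rpow (by positivity) (by positivity), Real.mul_rpow (by positivity) hD,
      Real.inv_rpow (by positivity), ← Real.rpow_mul hpos.le, mul_one_div]
    rfl

theorem exists_uniform_bounds {N : ℕ} (hN : 1 ≤ N) {c : Fin N → ℝ} (hc : ∀ i, 0 < c i) :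
    ∃ b B : ℝ, 0 < b ∧ 0 < B ∧ ∀ i, b ≤ c i ∧ c i ≤ B := by
  have : Nonempty (Fin N) := ⟨⟨0, hN⟩⟩
  obtain ⟨i, hi⟩ := Finite.exists_min c
  obtain ⟨o, ho⟩ := Finite.exists_max c
  exact ⟨c i, c o, hc i, hc o, fun k => ⟨hi k, ho k⟩⟩

end PTHybrid

/-! ### The two estimates, from the choice of the weight `a` -/

theorem mainTheorem6 {n m N : ℕ} (hN : 1 ≤ N)
    (f : Fin N → PTHybrid.Vec n × PTHybrid.Vec m × ℝ × ℝ → PTHybrid.Vec n)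
    (R : Fin N → PTHybrid.Vec n → PTHybrid.Vec n)
    (τd N₀ p : ℝ) (V : Fin N → PTHybrid.Vec n × ℝ → ℝ) (c₁ c₂ c₃ c₄ : Fin N → ℝ)
    (hτd : 0 < τd) (hN₀ : 1 ≤ N₀) (hreg : PTHybrid.RegularData f R)
    (hdwell : Real.log ((⨆ i, c₂ i) / (⨅ i, c₁ i)) / (⨅ i, c₃ i) < τd) :
    -- the cases `Δ = 0` and `Δ = 1`
    (∀ δ : ℝ, δ = 0 ∨ δ = 1 →
      PTHybrid.LyapunovConditions f R (fun _ => δ) τd N₀ p V c₁ c₂ c₃ c₄ →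
      ∃ κ₁ κ₂ κ₃ : ℝ, 0 < κ₁ ∧ 0 < κ₂ ∧ 0 < κ₃ ∧
        ∀ T : ℝ, 0 < T → ∀ u : ℝ → PTHybrid.Vec m, PTHybrid.RegularInput u →
        ∀ (E : Set (ℝ × ℕ)) (x : ℝ → ℕ → PTHybrid.Vec n) (τ q μ : ℝ → ℕ → ℝ),
        PTHybrid.IsSolutionPair (PTHybrid.switchingSystem f R τd N₀ T 1) E
          (fun t j => ((x t j, τ t j, q t j), μ t j)) (fun t _ => u t) →
        ∀ t j, (t, j) ∈ E →
          ‖x t j‖ ≤ κ₁ * (μ 0 0 / μ t j) ^ (κ₂ * T) * Real.exp (-κ₂ * j) * ‖x 0 0‖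
            + κ₃ * δ * PTHybrid.inputSup E (fun t _ => u t) t j) ∧
    -- the case `Δ = μ ^ (-ℓ)`
    (∀ ℓ : ℝ, 0 < ℓ →
      PTHybrid.LyapunovConditions f R (fun μ => μ ^ (-ℓ)) τd N₀ p V c₁ c₂ c₃ c₄ →
      ∀ T : ℝ, 0 < T →
      ∃ α₁ α₂ α₃ α₄ α₅ α₆ : ℝ, 0 < α₁ ∧ 0 < α₂ ∧ 0 < α₃ ∧ 0 < α₄ ∧ 0 < α₅ ∧ 0 < α₆ ∧
        ∀ u : ℝ → PTHybrid.Vec m, PTHybrid.RegularInput u →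
        ∀ (E : Set (ℝ × ℕ)) (x : ℝ → ℕ → PTHybrid.Vec n) (τ q μ : ℝ → ℕ → ℝ),
        PTHybrid.IsSolutionPair (PTHybrid.switchingSystem f R τd N₀ T 1) E
          (fun t j => ((x t j, τ t j, q t j), μ t j)) (fun t _ => u t) →
        ∀ t j, (t, j) ∈ E →
          ‖x t j‖ ≤ α₁ * μ 0 0 ^ α₂ / μ t j ^ α₃ *
            (Real.exp (-α₄ * j) / μ t j ^ α₅ * ‖x 0 0‖
              + α₆ * PTHybrid.inputSup E (fun t _ => u t) t j)) := by
  constructor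
  · intro δ hδ hL
    have hp := hL.exponent_pos
    obtain ⟨b₁, _, hb₁, _, hc₁⟩ := PTHybrid.exists_uniform_bounds hN fun i => (hL.const_pos i).1
    obtain ⟨_, b₂, _, hb₂, hc₂⟩ := PTHybrid.exists_uniform_bounds hN fun i => (hL.const_pos i).2.1
    obtain ⟨c, _, hc, _, hc₃⟩ := PTHybrid.exists_uniform_bounds hN fun i => (hL.const_pos i).2.2.1
    obtain ⟨_, C, _, hC, hc₄⟩ := PTHybrid.exists_uniform_bounds hN fun i => (hL.const_pos i).2.2.2
    have hδ0 : 0 ≤ δ := by rcases hδ with rfl | rfl <;> norm_num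
    -- With `a = 0` no constant depends on `T`. A single `κ₂` serves both decay factors, hence the
    -- minimum.
    refine ⟨(2 * (b₂ / b₁)) ^ (1 / p) * Real.exp (c * τd / (4 * p) * N₀),
      min (c / (4 * p)) (c * τd / (4 * p)), (4 * C / (c * b₁)) ^ (1 / p), by positivity,
      lt_min (by positivity) (by positivity), by positivity, ?_⟩
    intro T hT u hu E x τ q μ hsol t j htj
    obtain ⟨h1, h2, h3⟩ := PTHybrid.norm_le_of_solution (a := 0) (D := δ) hL hτd hT hc hC hb₁ hb₂
      (fun i => (hc₁ i).1) (fun i => (hc₂ i).2) (fun i => (hc₃ i).1) (fun i => (hc₄ i).2)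
      (by positivity) hδ0 (fun μ _ => by simpa using hδ0) hu hsol htj
    have hpos₀ : 0 < μ 0 0 := by linarith
    have hpos : 0 < μ t j := by linarith
    -- The root produced by `norm_le_of_solution` disappears because `δ` is `0` or `1`.
    have hδp : δ ^ (1 / p) = δ := by
      rcases hδ with rfl | rfl
      · exact Real.zero_rpow (by positivity)
      · exact Real.one_rpow _
    rw [hδp] at h3
    simp only [zero_div, zero_add, Real.rpow_zero, div_one] at h3
    refine h3.trans (add_le_add_left ?_ _)
    have e1 : (μ 0 0 / μ t j) ^ (c * T / (4 * p)) ≤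
        (μ 0 0 / μ t j) ^ (min (c / (4 * p)) (c * τd / (4 * p)) * T) := by
      refine Real.rpow_le_rpow_of_exponent_ge (by positivity) (div_le_one_of_le₀ h2 hpos.le) ?_
      calc _ ≤ c / (4 * p) * T := mul_le_mul_of_nonneg_right (min_le_left _ _) hT.le
        _ = _ := by ring
    have e2 : Real.exp (-(c * τd / (4 * p)) * j) ≤
        Real.exp (-min (c / (4 * p)) (c * τd / (4 * p)) * j) :=
      Real.exp_le_exp.2 (mul_le_mul_of_nonneg_right (neg_le_neg (min_le_right _ _))
        (Nat.cast_nonneg j))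
    gcongr
  · intro ℓ hℓ hL T hT
    have hp := hL.exponent_pos
    obtain ⟨b₁, _, hb₁, _, hc₁⟩ := PTHybrid.exists_uniform_bounds hN fun i => (hL.const_pos i).1
    obtain ⟨_, b₂, _, hb₂, hc₂⟩ := PTHybrid.exists_uniform_bounds hN fun i => (hL.const_pos i).2.1
    obtain ⟨c, _, hc, _, hc₃⟩ := PTHybrid.exists_uniform_bounds hN fun i => (hL.const_pos i).2.2.1
    obtain ⟨_, C, _, hC, hc₄⟩ := PTHybrid.exists_uniform_bounds hN fun i => (hL.const_pos i).2.2.2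
    -- `a ≤ ℓ` keeps `μ ^ a * μ ^ (-ℓ) ≤ 1`, and `a ≤ c * T / 2` is what the decay can afford; `a >
    -- 0` makes the input term vanish as `μ` grows.
    obtain ⟨a, ha, haℓ, hac⟩ : ∃ a : ℝ, 0 < a ∧ a ≤ ℓ ∧ a ≤ c * T / 2 :=
      ⟨min ℓ (c * T / 2), lt_min hℓ (by positivity), min_le_left _ _, min_le_right _ _⟩
    obtain ⟨K, hK⟩ : ∃ K, K = (2 * (b₂ / b₁)) ^ (1 / p) * Real.exp (c * τd / (4 * p) * N₀) :=
      ⟨_, rfl⟩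
    have hK0 : 0 < K := by rw [hK]; positivity
    -- The state term has `μ` to the power `-(a / p + c * T / (4 * p))`, the input term only `-(a /
    -- p)`: the common part is `α₃`, the excess `α₅`. Dividing by `K` in `α₆` cancels the prefactor
    -- `α₁`.
    refine ⟨K, a / p + c * T / (4 * p), a / p, c * τd / (4 * p), c * T / (4 * p),
      (4 * C / (c * b₁)) ^ (1 / p) / K, hK0, by positivity, by positivity, by positivity,
      by positivity, by positivity, ?_⟩
    intro u hu E x τ q μ hsol t j htj
    obtain ⟨h1, h2, h3⟩ := PTHybrid.norm_le_of_solution (a := a) (D := 1) hL hτd hT hc hC hb₁ hb₂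
      (fun i => (hc₁ i).1) (fun i => (hc₂ i).2) (fun i => (hc₃ i).1) (fun i => (hc₄ i).2)
      hac zero_le_one (fun μ hμ => ⟨by positivity, by
        rw [← Real.rpow_add (by linarith)]
        exact Real.rpow_le_one_of_one_le_of_nonpos hμ (by linarith)⟩) hu hsol htj
    have hpos₀ : 0 < μ 0 0 := by linarith
    have hpos : 0 < μ t j := by linarith
    rw [← hK, Real.one_rpow, mul_one, Real.div_rpow hpos₀.le hpos.le,
      Real.rpow_add hpos (a / p)] at h3
    -- The input term carries no power of `μ₀`; since `μ₀ ≥ 1`, it may be multiplied by the one in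
    -- the common prefactor.
    have e1 : 1 ≤ μ 0 0 ^ (a / p + c * T / (4 * p)) := Real.one_le_rpow h1 (by positivity)
    have hS := PTHybrid.inputSup_nonneg E (fun t _ => u t) t j
    refine h3.trans ?_
    rw [mul_add]
    refine add_le_add (le_of_eq ?_) ?_
    · field_simp
    · calc _ = 1 * ((4 * C / (c * b₁)) ^ (1 / p) / μ t j ^ (a / p) *
            PTHybrid.inputSup E (fun t _ => u t) t j) := by ring
        _ ≤ μ 0 0 ^ (a / p + c * T / (4 * p)) * ((4 * C / (c * b₁)) ^ (1 / p) / μ t j ^ (a / p) *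
            PTHybrid.inputSup E (fun t _ => u t) t j) := by gcongr
        _ = _ := by field_simp
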